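/- Let $\mathbb{F}$ be the free Carnot group of step 3 with 2 generators (the Cartan group), that is, $\mathbb{R}^5$ with the Lie group operation for which $$X_1=\partial_1,\qquad X_2=\partial_2-x_1\partial_3+\tfrac12x_1^2\partial_4+x_1x_2\partial_5,\qquad X_3=\partial_3-x_1\partial_4-x_2\partial_5,\qquad X_4=\partial_4,\qquad X_5=\partial_5$$ is a basis of the left-invariant vector fields; the only non-zero brackets are given by $[X_2,X_1]=X_3$, $[X_3,X_1]=X_4$, $[X_3,X_2]=X_5$. An absolutely continuous curve $\gamma\colon[a,b]\to\mathbb{R}^5$ is horizontal if there are $u_1,u_2\in L^1([a,b])$ with $\gamma'(t)=u_1(t)X_1(\gamma(t))+u_2(t)X_2(\gamma(t))$ for almost every $t\in[a,b]$; its length is $\ell(\gamma)=\int_a^b\sqrt{u_1^2+u_2^2}$. The Carnot–Carathéodory metric on $\mathbb{F}$ is $d_c(x,y)=\inf\{\ell(\gamma):\gamma\text{ is a horizontal curve joining }x\text{ and }y\}$. A curve in $\mathbb{F}$ is Lipschitz if it is Lipschitz with respect to $d_c$, and $C^1_H$ if it is horizontal and $C^1$ as a curve in $\mathbb{R}^5$.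 Theorem 1.2. There is a Lipschitz curve $\gamma\colon[0,1]\to\mathbb{F}$ such that, for every $C^1_H$ curve $\Gamma\colon[0,1]\to\mathbb{F}$, $$m\{t\in[0,1]:\Gamma(t)=\gamma(t)\}=0,$$ where $m$ denotes Lebesgue measure. -/

import Mathlib

open Set MeasureTheory
open scoped NNReal ENNReal ContDiff Manifold

noncomputable section

/-! The free Carnot group of step 3 with 2 generators (the Cartan group), in exponential
coordinates of the second kind. -/

/-- The underlying space `ℝ⁵`, with its Euclidean topology and smooth structure.  The coordinates
`x₁, …, x₅` of a point `x` are `x 0, …, x 4`. -/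
abbrev Cartan : Type := EuclideanSpace ℝ (Fin 5)

namespace Cartan

/-- The group operation. -/
def mul (x y : Cartan) : Cartan :=
  !₂[x 0 + y 0,
    x 1 + y 1,
    x 2 + y 2 - x 0 * y 1,
    x 3 + y 3 - x 0 * y 2 + 1 / 2 * x 0 ^ 2 * y 1,
    x 4 + y 4 - x 1 * y 2 + x 0 * x 1 * y 1 + 1 / 2 * x 0 * y 1 ^ 2]

/-- The inverse of the group operation. -/
def inv (x : Cartan) : Cartan :=
  !₂[-x 0,
    -x 1,
    -x 2 - x 0 * x 1,
    -x 3 - x 0 * x 2 - 1 / 2 * x 0 ^ 2 * x 1,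
    -x 4 - x 1 * x 2 - 1 / 2 * x 0 * x 1 ^ 2]

instance : Mul Cartan := ⟨mul⟩
instance : Inv Cartan := ⟨inv⟩
instance : One Cartan := ⟨0⟩

theorem mul_def (x y : Cartan) : x * y =
    !₂[x 0 + y 0,
      x 1 + y 1,
      x 2 + y 2 - x 0 * y 1,
      x 3 + y 3 - x 0 * y 2 + 1 / 2 * x 0 ^ 2 * y 1,
      x 4 + y 4 - x 1 * y 2 + x 0 * x 1 * y 1 + 1 / 2 * x 0 * y 1 ^ 2] := rfl

theorem inv_def (x : Cartan) : x⁻¹ =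
    !₂[-x 0,
      -x 1,
      -x 2 - x 0 * x 1,
      -x 3 - x 0 * x 2 - 1 / 2 * x 0 ^ 2 * x 1,
      -x 4 - x 1 * x 2 - 1 / 2 * x 0 * x 1 ^ 2] := rfl

theorem one_def : (1 : Cartan) = 0 := rfl

/-- `(ℝ⁵, *)` is a group; its identity element is the origin. -/
instance : Group Cartan :=
  Group.ofLeftAxioms
    (fun x y z => by
      ext i
      fin_cases i <;> simp [mul_def] <;> ring)
    (fun x => by
      ext i
      fin_cases i <;> simp [mul_def, one_def])
    (fun x => by
      ext i
      fin_cases i <;> simp [mul_def, inv_def, one_def] <;> ring)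

/-- The group operation is smooth. -/
theorem contDiff_mul : ContDiff ℝ ∞ (fun p : Cartan × Cartan => p.1 * p.2) := by
  rw [contDiff_euclidean]
  intro i
  fin_cases i <;> simp [mul_def] <;> fun_prop

/-- Inversion is smooth. -/
theorem contDiff_inv : ContDiff ℝ ∞ (fun x : Cartan => x⁻¹) := by
  rw [contDiff_euclidean]
  intro i
  fin_cases i <;> simp [inv_def] <;> fun_prop

/-- `(ℝ⁵, *)` is a Lie group. -/
instance : LieGroup 𝓘(ℝ, Cartan) ∞ Cartan where
  contMDiff_mul := by
    rw [← modelWithCornersSelf_prod, chartedSpaceSelf_prod]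
    exact contDiff_mul.contMDiff
  contMDiff_inv := contDiff_inv.contMDiff

/-- `X₁ = ∂₁`. -/
def X₁ (_ : Cartan) : Cartan := !₂[1, 0, 0, 0, 0]

/-- `X₂ = ∂₂ - x₁ ∂₃ + (1/2) x₁² ∂₄ + x₁ x₂ ∂₅`. -/
def X₂ (x : Cartan) : Cartan := !₂[0, 1, -x 0, 1 / 2 * x 0 ^ 2, x 0 * x 1]

/-- `X₃ = ∂₃ - x₁ ∂₄ - x₂ ∂₅`. -/
def X₃ (x : Cartan) : Cartan := !₂[0, 0, 1, -x 0, -x 1]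

/-- `X₄ = ∂₄`. -/
def X₄ (_ : Cartan) : Cartan := !₂[0, 0, 0, 1, 0]

/-- `X₅ = ∂₅`. -/
def X₅ (_ : Cartan) : Cartan := !₂[0, 0, 0, 0, 1]

/-- A vector field on `ℝ⁵` is left invariant if `dL_x(y) X(y) = X(x * y)` for all `x, y`. -/
def IsLeftInvariant (X : Cartan → Cartan) : Prop :=
  ∀ x y : Cartan, fderiv ℝ (fun z : Cartan => x * z) y (X y) = X (x * y)

/-- The derivative of a map `ℝ⁵ → ℝ⁵`, computed coordinatewise along lines. -/
theorem fderiv_apply_eq {F : Cartan → Cartan} {y v w : Cartan} (hF : ContDiff ℝ ∞ F)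
    (h : ∀ i, deriv (fun t : ℝ => F (y + t • v) i) 0 = w i) : fderiv ℝ F y v = w := by
  have hd : DifferentiableAt ℝ F y := (hF.differentiable (by simp)).differentiableAt
  ext i
  rw [← h i]
  have h1 : HasDerivAt (fun t : ℝ => F (y + t • v)) (fderiv ℝ F y v) 0 :=
    (hd.hasFDerivAt.hasLineDerivAt v).congr_deriv rfl
  exact (((EuclideanSpace.proj (𝕜 := ℝ) i).hasFDerivAt.comp_hasDerivAt 0 h1).deriv).symm

theorem contDiff_X₂ : ContDiff ℝ ∞ X₂ := by
  rw [contDiff_euclidean]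
  intro i
  fin_cases i <;> simp [X₂] <;> fun_prop

theorem contDiff_X₃ : ContDiff ℝ ∞ X₃ := by
  rw [contDiff_euclidean]
  intro i
  fin_cases i <;> simp [X₃] <;> fun_prop

theorem contDiff_mul_left (x : Cartan) : ContDiff ℝ ∞ (fun z : Cartan => x * z) :=
  contDiff_mul.comp (contDiff_const.prodMk contDiff_id)

/-- `X₁, …, X₅` are left invariant. -/
theorem isLeftInvariant : IsLeftInvariant X₁ ∧ IsLeftInvariant X₂ ∧ IsLeftInvariant X₃ ∧
    IsLeftInvariant X₄ ∧ IsLeftInvariant X₅ := by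
  refine ⟨?_, ?_, ?_, ?_, ?_⟩ <;> intro x y <;>
    refine fderiv_apply_eq (contDiff_mul_left x) fun i => ?_ <;> fin_cases i <;>
    simp (disch := fun_prop) [mul_def, X₁, X₂, X₃, X₄, X₅,
      deriv_fun_add, deriv_fun_sub, deriv_fun_mul, deriv_fun_pow] <;> ring

theorem fderiv_X₁ (y v : Cartan) : fderiv ℝ X₁ y v = 0 := by
  simp [show X₁ = Function.const Cartan !₂[1, 0, 0, 0, 0] from rfl]

theorem fderiv_X₂ (y v : Cartan) :
    fderiv ℝ X₂ y v = !₂[0, 0, -v 0, y 0 * v 0, v 0 * y 1 + y 0 * v 1] := by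
  refine fderiv_apply_eq contDiff_X₂ fun i => ?_
  fin_cases i <;> simp (disch := fun_prop) [X₂,
    deriv_fun_add, deriv_fun_mul, deriv_fun_pow] <;> ring

theorem fderiv_X₃ (y v : Cartan) : fderiv ℝ X₃ y v = !₂[0, 0, 0, -v 0, -v 1] := by
  refine fderiv_apply_eq contDiff_X₃ fun i => ?_
  fin_cases i <;> simp (disch := fun_prop) [X₃, deriv_fun_add]

theorem fderiv_X₄ (y v : Cartan) : fderiv ℝ X₄ y v = 0 := by
  simp [show X₄ = Function.const Cartan !₂[0, 0, 0, 1, 0] from rfl]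

theorem fderiv_X₅ (y v : Cartan) : fderiv ℝ X₅ y v = 0 := by
  simp [show X₅ = Function.const Cartan !₂[0, 0, 0, 0, 1] from rfl]

/-- The bracket relations `[X₂, X₁] = X₃`, `[X₃, X₁] = X₄`, `[X₃, X₂] = X₅` of the free nilpotent
Lie algebra of step 3 with 2 generators. Mathlib's `VectorField.lieBracket ℝ V W` is
`x ↦ DW(x) V(x) - DV(x) W(x)`, that is, the commutator `VW - WV`. -/
theorem lieBracket_generators : VectorField.lieBracket ℝ X₂ X₁ = X₃ ∧
    VectorField.lieBracket ℝ X₃ X₁ = X₄ ∧ VectorField.lieBracket ℝ X₃ X₂ = X₅ := by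
  refine ⟨?_, ?_, ?_⟩ <;> ext x i <;> fin_cases i <;>
    simp [VectorField.lieBracket, fderiv_X₁, fderiv_X₂, fderiv_X₃, X₁, X₂, X₃, X₄, X₅]

/-- All other brackets of `X₁, …, X₅` vanish. -/
theorem lieBracket_vanish : VectorField.lieBracket ℝ X₁ X₄ = 0 ∧
    VectorField.lieBracket ℝ X₁ X₅ = 0 ∧ VectorField.lieBracket ℝ X₂ X₄ = 0 ∧
    VectorField.lieBracket ℝ X₂ X₅ = 0 ∧ VectorField.lieBracket ℝ X₃ X₄ = 0 ∧
    VectorField.lieBracket ℝ X₃ X₅ = 0 ∧ VectorField.lieBracket ℝ X₄ X₅ = 0 := by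
  refine ⟨?_, ?_, ?_, ?_, ?_, ?_, ?_⟩ <;> ext x i <;> fin_cases i <;>
    simp [VectorField.lieBracket, fderiv_X₁, fderiv_X₂, fderiv_X₃, fderiv_X₄, fderiv_X₅,
      X₁, X₂, X₃, X₄, X₅]

/-- `u₁, u₂` are controls of the curve `γ` on `[a, b]`: `γ` is absolutely continuous on `[a, b]`,
`u₁` and `u₂` are in `L¹([a, b])`, and `γ'(t) = u₁(t) X₁(γ(t)) + u₂(t) X₂(γ(t))` for almost every
`t ∈ [a, b]`. A curve on `[a, b]` is represented by a map on `ℝ`, of which only the restriction to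
`[a, b]` matters. -/
structure IsControlled (γ : ℝ → Cartan) (u₁ u₂ : ℝ → ℝ) (a b : ℝ) : Prop where
  absolutelyContinuous : AbsolutelyContinuousOnInterval γ a b
  integrable_fst : IntegrableOn u₁ (Icc a b)
  integrable_snd : IntegrableOn u₂ (Icc a b)
  hasDerivAt : ∀ᵐ t ∂(volume.restrict (Icc a b)),
    HasDerivAt γ (u₁ t • X₁ (γ t) + u₂ t • X₂ (γ t)) t

/-- An (absolutely continuous) curve `γ` on `[a, b]` is horizontal if it has controls. -/
def IsHorizontal (γ : ℝ → Cartan) (a b : ℝ) : Prop :=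
  ∃ u₁ u₂ : ℝ → ℝ, IsControlled γ u₁ u₂ a b

/-- The length `∫_a^b √(u₁² + u₂²)` of a horizontal curve with controls `u₁, u₂`. (The curve
determines its controls up to null sets.) -/
def controlLength (u₁ u₂ : ℝ → ℝ) (a b : ℝ) : ℝ≥0∞ :=
  ∫⁻ t in Icc a b, ENNReal.ofReal √(u₁ t ^ 2 + u₂ t ^ 2)

/-- The Carnot-Carathéodory metric: the infimum of the lengths of the horizontal curves joining
`x` and `y`, as an extended real (so that an infimum over the empty set would be `∞`, not `0`). -/
def ccDist (x y : Cartan) : ℝ≥0∞ :=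
  sInf {ℓ : ℝ≥0∞ | ∃ (a b : ℝ) (γ : ℝ → Cartan) (u₁ u₂ : ℝ → ℝ), a ≤ b ∧
    IsControlled γ u₁ u₂ a b ∧ γ a = x ∧ γ b = y ∧ ℓ = controlLength u₁ u₂ a b}

/-- `γ` is an `L`-Lipschitz curve on `I` with respect to the Carnot-Carathéodory metric. -/
def IsLipschitzCurve (L : ℝ) (γ : ℝ → Cartan) (I : Set ℝ) : Prop :=
  ∀ s ∈ I, ∀ t ∈ I, ccDist (γ s) (γ t) ≤ ENNReal.ofReal (L * |s - t|)

/-- `γ` is a `C¹_H` curve on `[a, b]`: it is horizontal and it is `C¹` as a curve in `ℝ⁵` (with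
one-sided derivatives at the endpoints). -/
def IsC1H (γ : ℝ → Cartan) (a b : ℝ) : Prop :=
  IsHorizontal γ a b ∧ ContDiffOn ℝ 1 γ (Icc a b)

end Cartan

end

/-!
The Cartan group has an abnormal line in every horizontal direction, and this gives a one-sided
constraint on `C¹` curves. Fix a direction `θ = p + iq`. Along a horizontal curve with control
`u = u₁ + i u₂` starting at `x`, let `y` be the displacement transverse to `θ`, and consider the
integral of `½ y² · Re (u θ̄)`. The group law makes this integral a polynomial `drift p q` of the two
endpoints (`hasDerivWithinAt_drift`). If `u` is continuous and close to a positive multiple of `θ`,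
the integrand is nonnegative, so the drift between any two nearby points of a `C¹_H` curve moving in
direction `θ` is nonnegative (`drift_nonneg`).

The Lipschitz curve violates this sign near almost every parameter. Its control `control` takes the
values `±1`, `±i`. It is the limit of controls `stage n`, constant on the cells of a grid with
`cells n` cells per unit length: in the middle of each cell where the direction is `θ`, three short
pieces of length `1 / cells (n + 1)` are replaced by `iθ`, `-θ`, `-iθ`. The curve steps sideways,
runs backwards, and steps back, so that the drift across the cell becomes negative, of order
`-(1 / cells (n + 1))³` (`integral_detour_neg`). The ratios `branching n` between successive grids
grow so fast that the detours of all later generations are negligible compared with this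
(`drift_lift_control_neg`). They are also summable, so almost every `t` lies in finitely many
detours, and the curve has direction `control t = stage n t` there for all large `n`.

If a `C¹_H` curve `Γ` agreed with this curve on a set `K` of positive measure, take a density point
`x` of `K`. Both curves have the same velocity at `x`. In every small cell around `x` there are
points of `K` before and after the detour; the drift between them is nonnegative because they lie on
`Γ` and negative because they lie on the other curve (`volume_eq_lift_control`).
-/

open Filter Topology

namespace Cartan

/-! ### Horizontal curves and the transverse drift -/

/-- The transverse drift between `x` and `y` in the direction `(p, q)`, as a polynomial in the
coordinates. Along a horizontal curve `γ` from `x` it is the integral of one half of the square of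
the displacement of `γ` transverse to `(p, q)` times the component of the control along `(p, q)`; see
`hasDerivWithinAt_drift`. The coefficients of `q` and `p` in the first factor are the integrals
of `½ (γ₁ - x₁)² u₂` and `½ (γ₂ - x₂)² u₁`. -/
noncomputable def drift (p q : ℝ) (x y : Cartan) : ℝ :=
  (p ^ 2 + q ^ 2) *
      (q * (y 3 - x 3 + x 0 * (y 2 - x 2) + 1 / 2 * x 0 ^ 2 * (y 1 - x 1)) +
       p * (1 / 2 * y 0 * y 1 ^ 2 - y 4 - (1 / 2 * x 0 * x 1 ^ 2 - x 4) -
         x 1 * (y 0 * y 1 + y 2 - x 0 * x 1 - x 2) + 1 / 2 * x 1 ^ 2 * (y 0 - x 0))) +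
    p * q * (p / 6 * (y 1 - x 1) ^ 3 - p / 2 * (y 0 - x 0) ^ 2 * (y 1 - x 1) -
      q / 2 * (y 0 - x 0) * (y 1 - x 1) ^ 2 + q / 6 * (y 0 - x 0) ^ 3)

theorem drift_self (p q : ℝ) (x : Cartan) : drift p q x x = 0 := by
  unfold drift; ring

theorem hasDerivWithinAt_coord {γ : ℝ → Cartan} {v : Cartan} {S : Set ℝ} {r : ℝ}
    (h : HasDerivWithinAt γ v S r) (i : Fin 5) : HasDerivWithinAt (fun r => γ r i) (v i) S r :=
  (EuclideanSpace.proj (𝕜 := ℝ) i).hasFDerivAt.comp_hasDerivWithinAt r h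

/-- The derivative of the drift along a horizontal curve has the sign of the component of the control
in the direction `(p, q)`. -/
theorem hasDerivWithinAt_drift (p q : ℝ) (x : Cartan) {γ : ℝ → Cartan} {u₁ u₂ : ℝ} {S : Set ℝ}
    {r : ℝ} (h : HasDerivWithinAt γ (u₁ • X₁ (γ r) + u₂ • X₂ (γ r)) S r) :
    HasDerivWithinAt (fun r => drift p q x (γ r))
      (1 / 2 * (p * (γ r 1 - x 1) - q * (γ r 0 - x 0)) ^ 2 * (p * u₁ + q * u₂)) S r := by
  have h0 : HasDerivWithinAt (fun r => γ r 0) u₁ S r := by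
    simpa [X₁, X₂] using hasDerivWithinAt_coord h 0
  have h1 : HasDerivWithinAt (fun r => γ r 1) u₂ S r := by
    simpa [X₁, X₂] using hasDerivWithinAt_coord h 1
  have h2 : HasDerivWithinAt (fun r => γ r 2) (u₂ * (-γ r 0)) S r := by
    simpa [X₁, X₂] using hasDerivWithinAt_coord h 2
  have h3 : HasDerivWithinAt (fun r => γ r 3) (u₂ * (1 / 2 * γ r 0 ^ 2)) S r := by
    simpa [X₁, X₂] using hasDerivWithinAt_coord h 3
  have h4 : HasDerivWithinAt (fun r => γ r 4) (u₂ * (γ r 0 * γ r 1)) S r := by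
    simpa [X₁, X₂] using hasDerivWithinAt_coord h 4
  have d0 := h0.sub_const (x 0)
  have d1 := h1.sub_const (x 1)
  have e4 := ((h3.sub_const (x 3)).add ((h2.sub_const (x 2)).const_mul (x 0))).add
    (d1.const_mul (1 / 2 * x 0 ^ 2))
  have e5 := (((((h0.const_mul (1 / 2)).mul (h1.pow 2)).sub h4).sub_const
    (1 / 2 * x 0 * x 1 ^ 2 - x 4)).sub
      (((((h0.mul h1).add h2).sub_const (x 0 * x 1)).sub_const (x 2)).const_mul (x 1))).add
        (d0.const_mul (1 / 2 * x 1 ^ 2))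
  have e := (((e4.const_mul q).add (e5.const_mul p)).const_mul (p ^ 2 + q ^ 2)).add
    ((((((d1.pow 3).const_mul (p / 6)).sub (((d0.pow 2).const_mul (p / 2)).mul d1)).sub
      ((d0.const_mul (q / 2)).mul (d1.pow 2))).add ((d0.pow 3).const_mul (q / 6))).const_mul (p * q))
  refine (e.congr_deriv ?_).congr_of_eventuallyEq ?_ ?_
  · simp; ring
  · exact Eventually.of_forall fun r => by simp [drift]
  · simp [drift]

/-- A `C¹_H` curve has continuous controls, with which the equation of horizontality holds at every
point: both sides of the equation are continuous and agree almost everywhere. -/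
theorem IsC1H.exists_continuousOn_controls {Γ : ℝ → Cartan} {a b : ℝ} (hab : a < b)
    (h : IsC1H Γ a b) :
    ∃ v₁ v₂ : ℝ → ℝ, ContinuousOn v₁ (Icc a b) ∧ ContinuousOn v₂ (Icc a b) ∧
      ∀ t ∈ Icc a b, HasDerivWithinAt Γ (v₁ t • X₁ (Γ t) + v₂ t • X₂ (Γ t)) (Icc a b) t := by
  obtain ⟨⟨u₁, u₂, hu⟩, hΓ⟩ := h
  have hU : UniqueDiffOn ℝ (Icc a b) := uniqueDiffOn_Icc hab
  have hV : ContinuousOn (derivWithin Γ (Icc a b)) (Icc a b) :=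
    hΓ.continuousOn_derivWithin hU le_rfl
  have hVi : ∀ i, ContinuousOn (fun t => derivWithin Γ (Icc a b) t i) (Icc a b) := fun i =>
    (EuclideanSpace.proj (𝕜 := ℝ) i).continuous.comp_continuousOn hV
  have hX₂ : ContinuousOn (fun t => X₂ (Γ t)) (Icc a b) :=
    contDiff_X₂.continuous.comp_continuousOn hΓ.continuousOn
  refine ⟨fun t => derivWithin Γ (Icc a b) t 0, fun t => derivWithin Γ (Icc a b) t 1,
    hVi 0, hVi 1, ?_⟩
  have key : EqOn (derivWithin Γ (Icc a b)) (fun t => derivWithin Γ (Icc a b) t 0 • X₁ (Γ t) +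
      derivWithin Γ (Icc a b) t 1 • X₂ (Γ t)) (Icc a b) := by
    refine Measure.eqOn_Icc_of_ae_eq volume hab.ne ?_ hV
      (((hVi 0).smul continuousOn_const).add ((hVi 1).smul hX₂))
    filter_upwards [hu.hasDerivAt, ae_restrict_mem measurableSet_Icc] with t ht htI
    rw [ht.hasDerivWithinAt.derivWithin (hU t htI)]
    simp [X₁, X₂]
  intro t ht
  have h1 := (hΓ.differentiableOn (by simp) t ht).hasDerivWithinAt
  rwa [key ht] at h1

/-- The one-sided constraint on curves whose controls never point against `(p, q)`. -/
theorem drift_nonneg {Γ : ℝ → Cartan} {v₁ v₂ : ℝ → ℝ} {p q s t : ℝ} (hst : s ≤ t)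
    (hΓ : ∀ r ∈ Icc s t, HasDerivWithinAt Γ (v₁ r • X₁ (Γ r) + v₂ r • X₂ (Γ r)) (Icc s t) r)
    (hpos : ∀ r ∈ Icc s t, 0 ≤ p * v₁ r + q * v₂ r) : 0 ≤ drift p q (Γ s) (Γ t) := by
  have hd := fun r hr => hasDerivWithinAt_drift p q (Γ s) (hΓ r hr)
  have hm : MonotoneOn (fun r => drift p q (Γ s) (Γ r)) (Icc s t) := by
    refine monotoneOn_of_hasDerivWithinAt_nonneg (convex_Icc s t)
      (fun r hr => (hd r hr).continuousWithinAt)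
      (fun r hr => (hd r (interior_subset hr)).mono interior_subset) fun r hr => ?_
    have := hpos r (interior_subset hr)
    positivity
  simpa [drift_self] using hm (left_mem_Icc.2 hst) (right_mem_Icc.2 hst) hst

/-- The velocity of the horizontal curve from the origin with controls `Re u`, `Im u`. The fields
`X₁`, `X₂` depend only on the first two coordinates, which are primitives of the controls, so the
velocity is explicit. -/
noncomputable def liftVelocity (u : ℝ → ℂ) (t : ℝ) : Cartan :=
  (u t).re • X₁ 0 +
    (u t).im • X₂ !₂[∫ r in (0 : ℝ)..t, (u r).re, ∫ r in (0 : ℝ)..t, (u r).im, 0, 0, 0]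

/-- The horizontal curve from the origin with controls `Re u`, `Im u`; the control is a complex-valued
function, so that rotations of the horizontal plane are multiplications. -/
noncomputable def lift (u : ℝ → ℂ) (t : ℝ) : Cartan := ∫ r in (0 : ℝ)..t, liftVelocity u r

section Lift

variable {u : ℝ → ℂ}

theorem locallyIntegrable_of_abs_le_one {f : ℝ → ℝ} (hf : Measurable f) (h : ∀ t, |f t| ≤ 1) :
    LocallyIntegrable f :=
  (locallyIntegrable_const (1 : ℝ)).mono hf.aestronglyMeasurable
    (Eventually.of_forall fun t => by simpa using h t)

theorem intervalIntegrable_of_locallyIntegrable {E : Type*} [NormedAddCommGroup E] {f : ℝ → E}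
    (hf : LocallyIntegrable f) (a b : ℝ) : IntervalIntegrable f volume a b :=
  intervalIntegrable_iff.2 ((hf.integrableOn_isCompact isCompact_uIcc).mono_set uIoc_subset_uIcc)

theorem measurable_liftVelocity_and_exists_bound (hu : Measurable u) (h1 : ∀ t, ‖u t‖ = 1) :
    Measurable (liftVelocity u) ∧ ∃ B : ℝ → ℝ, Continuous B ∧ ∀ t, ‖liftVelocity u t‖ ≤ B t := by
  have hre : Continuous fun t => ∫ r in (0 : ℝ)..t, (u r).re :=
    intervalIntegral.continuous_primitive (intervalIntegrable_of_locallyIntegrable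
      (locallyIntegrable_of_abs_le_one (Complex.measurable_re.comp hu) fun t => by
        simpa [h1] using Complex.abs_re_le_norm (u t))) 0
  have him : Continuous fun t => ∫ r in (0 : ℝ)..t, (u r).im :=
    intervalIntegral.continuous_primitive (intervalIntegrable_of_locallyIntegrable
      (locallyIntegrable_of_abs_le_one (Complex.measurable_im.comp hu) fun t => by
        simpa [h1] using Complex.abs_im_le_norm (u t))) 0
  have hZ : Continuous fun t => X₂ !₂[∫ r in (0 : ℝ)..t, (u r).re,
      ∫ r in (0 : ℝ)..t, (u r).im, 0, 0, 0] := by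
    refine contDiff_X₂.continuous.comp ?_
    refine (PiLp.continuous_toLp 2 _).comp (continuous_pi fun i => ?_)
    fin_cases i <;> simp <;> fun_prop
  refine ⟨?_, fun t => ‖X₁ 0‖ + ‖X₂ !₂[∫ r in (0 : ℝ)..t, (u r).re,
      ∫ r in (0 : ℝ)..t, (u r).im, 0, 0, 0]‖, by fun_prop, fun t => ?_⟩
  · unfold liftVelocity
    exact ((Complex.measurable_re.comp hu).smul_const _).add
      ((Complex.measurable_im.comp hu).smul hZ.measurable)
  · have a1 := (Complex.abs_re_le_norm (u t)).trans (h1 t).le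
    have a2 := (Complex.abs_im_le_norm (u t)).trans (h1 t).le
    refine (norm_add_le _ _).trans (add_le_add ?_ ?_) <;> rw [norm_smul, Real.norm_eq_abs]
    · exact mul_le_of_le_one_left (norm_nonneg _) a1
    · exact mul_le_of_le_one_left (norm_nonneg _) a2

theorem locallyIntegrable_liftVelocity (hu : Measurable u) (h1 : ∀ t, ‖u t‖ = 1) :
    LocallyIntegrable (liftVelocity u) := by
  obtain ⟨hm, B, hB, hle⟩ := measurable_liftVelocity_and_exists_bound hu h1
  exact hB.locallyIntegrable.mono hm.aestronglyMeasurable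
    (Eventually.of_forall fun t => (hle t).trans (le_abs_self _))

theorem lift_apply (hu : Measurable u) (h1 : ∀ t, ‖u t‖ = 1) (t : ℝ) (i : Fin 5) :
    lift u t i = ∫ r in (0 : ℝ)..t, liftVelocity u r i :=
  ((EuclideanSpace.proj (𝕜 := ℝ) i).intervalIntegral_comp_comm
    (intervalIntegrable_of_locallyIntegrable (locallyIntegrable_liftVelocity hu h1) 0 t)).symm

theorem lift_apply_zero (hu : Measurable u) (h1 : ∀ t, ‖u t‖ = 1) (t : ℝ) :
    lift u t 0 = ∫ r in (0 : ℝ)..t, (u r).re := by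
  rw [lift_apply hu h1]; simp [liftVelocity, X₁, X₂]

theorem lift_apply_one (hu : Measurable u) (h1 : ∀ t, ‖u t‖ = 1) (t : ℝ) :
    lift u t 1 = ∫ r in (0 : ℝ)..t, (u r).im := by
  rw [lift_apply hu h1]; simp [liftVelocity, X₁, X₂]

theorem ae_hasDerivAt_lift (hu : Measurable u) (h1 : ∀ t, ‖u t‖ = 1) :
    ∀ᵐ t, HasDerivAt (lift u) ((u t).re • X₁ (lift u t) + (u t).im • X₂ (lift u t)) t := by
  filter_upwards [_root_.LocallyIntegrable.ae_hasDerivAt_integral (locallyIntegrable_liftVelocity hu h1)] with t ht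
  refine (ht 0).congr_deriv ?_
  ext i
  fin_cases i <;> simp [liftVelocity, X₁, X₂, lift_apply_zero hu h1, lift_apply_one hu h1]

theorem exists_lipschitzOnWith_lift (hu : Measurable u) (h1 : ∀ t, ‖u t‖ = 1) (a b : ℝ) :
    ∃ K : ℝ≥0, LipschitzOnWith K (lift u) (uIcc a b) := by
  obtain ⟨-, B, hB, hle⟩ := measurable_liftVelocity_and_exists_bound hu h1
  obtain ⟨C, hC⟩ := isCompact_uIcc.exists_bound_of_continuousOn (hB.continuousOn (s := uIcc a b))
  refine ⟨C.toNNReal, LipschitzOnWith.of_dist_le_mul fun s hs t ht => ?_⟩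
  have hI := intervalIntegrable_of_locallyIntegrable (locallyIntegrable_liftVelocity hu h1)
  rw [dist_eq_norm, lift, lift, intervalIntegral.integral_interval_sub_left (hI _ _) (hI _ _), Real.dist_eq]
  refine intervalIntegral.norm_integral_le_of_norm_le_const fun r hr => ?_
  have hr' : r ∈ uIcc a b := uIcc_subset_uIcc ht hs (uIoc_subset_uIcc hr)
  exact ((hle r).trans ((le_abs_self _).trans (hC r hr'))).trans (Real.le_coe_toNNReal C)

theorem isControlled_of_lipschitzOnWith {γ : ℝ → Cartan} {u₁ u₂ : ℝ → ℝ} {a b : ℝ} {K : ℝ≥0}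
    (hγ : LipschitzOnWith K γ (uIcc a b)) (h₁ : LocallyIntegrable u₁) (h₂ : LocallyIntegrable u₂)
    (h : ∀ᵐ t, HasDerivAt γ (u₁ t • X₁ (γ t) + u₂ t • X₂ (γ t)) t) : IsControlled γ u₁ u₂ a b :=
  ⟨hγ.absolutelyContinuousOnInterval, h₁.integrableOn_isCompact isCompact_Icc,
    h₂.integrableOn_isCompact isCompact_Icc, ae_restrict_of_ae h⟩

theorem ccDist_le_of_isControlled {γ : ℝ → Cartan} {u₁ u₂ : ℝ → ℝ} {a b : ℝ} (hab : a ≤ b)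
    (h : IsControlled γ u₁ u₂ a b) (h1 : ∀ t, u₁ t ^ 2 + u₂ t ^ 2 = 1) :
    ccDist (γ a) (γ b) ≤ ENNReal.ofReal (b - a) := by
  refine sInf_le ⟨a, b, γ, u₁, u₂, hab, h, rfl, rfl, ?_⟩
  simp [controlLength, h1]

theorem isLipschitzCurve_lift (hu : Measurable u) (h1 : ∀ t, ‖u t‖ = 1) (S : Set ℝ) :
    IsLipschitzCurve 1 (lift u) S := by
  have hsq : ∀ t, (u t).re ^ 2 + (u t).im ^ 2 = 1 := fun t => by
    rw [← Complex.sq_norm_sub_sq_re, h1]; ring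
  have hre := Complex.measurable_re.comp hu
  have him := Complex.measurable_im.comp hu
  have hre1 : ∀ t, |(u t).re| ≤ 1 := fun t => by simpa [h1] using Complex.abs_re_le_norm (u t)
  have him1 : ∀ t, |(u t).im| ≤ 1 := fun t => by simpa [h1] using Complex.abs_im_le_norm (u t)
  have hd := ae_hasDerivAt_lift hu h1
  intro s _ t _
  obtain ⟨K, hK⟩ := exists_lipschitzOnWith_lift hu h1 s t
  rcases le_total s t with hst | hts
  · have := ccDist_le_of_isControlled hst (isControlled_of_lipschitzOnWith hK
      (locallyIntegrable_of_abs_le_one hre hre1) (locallyIntegrable_of_abs_le_one him him1) hd) hsq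
    rwa [one_mul, abs_sub_comm, abs_of_nonneg (sub_nonneg.2 hst)]
  · -- traverse the arc backwards
    have hσ : Measurable fun r : ℝ => t + s - r := by fun_prop
    have hK' : LipschitzOnWith K (fun r => lift u (t + s - r)) (uIcc t s) := by
      have hl : LipschitzWith 1 fun r : ℝ => t + s - r :=
        LipschitzWith.of_dist_le_mul fun x y => by
          rw [Real.dist_eq, Real.dist_eq, sub_sub_sub_cancel_left, abs_sub_comm]; simp
      have := hK.comp (hl.lipschitzOnWith (s := uIcc t s)) fun r hr => ?_
      · rwa [mul_one] at this
      · rw [uIcc_of_le hts] at hr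
        rw [uIcc_of_ge hts]
        exact ⟨by linarith [hr.2], by linarith [hr.1]⟩
    have hd' : ∀ᵐ r, HasDerivAt (fun r => lift u (t + s - r))
        ((-(u (t + s - r)).re) • X₁ (lift u (t + s - r)) +
          (-(u (t + s - r)).im) • X₂ (lift u (t + s - r))) r := by
      filter_upwards [(Measure.measurePreserving_sub_left volume (t + s)).quasiMeasurePreserving.ae hd]
        with r hr
      have := hr.scomp r ((hasDerivAt_id r).const_sub (t + s))
      refine this.congr_deriv ?_
      simp only [neg_smul, one_smul, neg_add]
    have := ccDist_le_of_isControlled hts (isControlled_of_lipschitzOnWith hK'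
      (locallyIntegrable_of_abs_le_one (hre.comp hσ).neg fun r => by simpa using hre1 _)
      (locallyIntegrable_of_abs_le_one (him.comp hσ).neg fun r => by simpa using him1 _) hd')
      (fun r => by simpa using hsq (t + s - r))
    simpa [abs_of_nonneg (sub_nonneg.2 hts)] using this

/-- The drift between two points of a lift, as an integral: the fundamental theorem of calculus
for the absolutely continuous function `r ↦ drift p q (lift u s) (lift u r)`. -/
theorem drift_lift (hu : Measurable u) (h1 : ∀ t, ‖u t‖ = 1) (p q s t : ℝ) :
    drift p q (lift u s) (lift u t) = ∫ r in s..t, 1 / 2 *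
      (∫ z in s..r, (p * (u z).im - q * (u z).re)) ^ 2 * (p * (u r).re + q * (u r).im) := by
  have hre : ∀ a b, IntervalIntegrable (fun t => (u t).re) volume a b :=
    intervalIntegrable_of_locallyIntegrable
    (locallyIntegrable_of_abs_le_one (Complex.measurable_re.comp hu) fun t => by
      simpa [h1] using Complex.abs_re_le_norm (u t))
  have him : ∀ a b, IntervalIntegrable (fun t => (u t).im) volume a b :=
    intervalIntegrable_of_locallyIntegrable
    (locallyIntegrable_of_abs_le_one (Complex.measurable_im.comp hu) fun t => by
      simpa [h1] using Complex.abs_im_le_norm (u t))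
  obtain ⟨K, hK⟩ := exists_lipschitzOnWith_lift hu h1 s t
  have hsmooth : ContDiff ℝ 1 (drift p q (lift u s)) := by
    unfold drift
    fun_prop
  obtain ⟨K', hK'⟩ := hsmooth.locallyLipschitz.locallyLipschitzOn.exists_lipschitzOnWith_of_compact
    (isCompact_uIcc.image_of_continuousOn hK.continuousOn)
  have hac := (hK'.comp hK (mapsTo_image _ _)).absolutelyContinuousOnInterval
  have hFTC := hac.integral_deriv_eq_sub
  simp only [Function.comp_apply, drift_self, sub_zero] at hFTC
  rw [← hFTC]
  refine intervalIntegral.integral_congr_ae ?_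
  filter_upwards [ae_hasDerivAt_lift hu h1] with r hr _
  have hd := (hasDerivWithinAt_drift p q (lift u s) hr.hasDerivWithinAt (S := univ)).hasDerivAt
    univ_mem
  have e1 : ∫ z in s..r, (p * (u z).im - q * (u z).re) =
      p * (lift u r 1 - lift u s 1) - q * (lift u r 0 - lift u s 0) := by
    simp only [lift_apply_zero hu h1, lift_apply_one hu h1]
    have a0 := intervalIntegral.integral_interval_sub_left (hre 0 r) (hre 0 s)
    have a1 := intervalIntegral.integral_interval_sub_left (him 0 r) (him 0 s)
    rw [a0, a1, intervalIntegral.integral_sub ((him s r).const_mul p) ((hre s r).const_mul q),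
      intervalIntegral.integral_const_mul, intervalIntegral.integral_const_mul]
  rw [e1]
  exact hd.deriv

end Lift

/-! ### One detour -/

/-- The number of quarter turns made on the `m`-th piece of a detour: the direction is rotated by
`i`, `-1`, `-i` on the pieces `0`, `1`, `2`, and is unchanged elsewhere. -/
def turns (m : ℤ) : ℕ := if m = 0 then 1 else if m = 1 then 2 else if m = 2 then 3 else 0

theorem turns_eq_zero_iff {m : ℤ} : turns m = 0 ↔ m < 0 ∨ 3 ≤ m := by
  unfold turns
  grind

theorem integral_indicator_Ico_one {s b l r : ℝ} (hsb : s ≤ b) (hsr : s ≤ r) :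
    ∫ z in s..r, (Ico b (b + l)).indicator (fun _ => (1 : ℝ)) z = max 0 (min (r - b) l) := by
  rw [intervalIntegral.integral_of_le hsr, integral_indicator measurableSet_Ico,
    Measure.restrict_restrict measurableSet_Ico,
    Measure.restrict_congr_set (Ico_ae_eq_Ioc.inter (ae_eq_refl (Ioc s r)))]
  simp only [Ioc_inter_Ioc, max_eq_left hsb, MeasureTheory.integral_const, smul_eq_mul, mul_one,
    measureReal_restrict_apply_univ, Real.volume_real_Ioc]
  rw [max_comm, ← min_sub_sub_right, min_comm]
  simp

/-- A control which, outside a small set `E`, makes one detour of three pieces of length `l` starting at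
`b` has negative drift in the direction `1`. Twice the drift is at most `-l³`, from the detour, plus
the left side of `hsmall`, from `E`. -/
theorem integral_detour_neg {f : ℝ → ℂ} (hf : Measurable f) (h1 : ∀ r, ‖f r‖ = 1)
    {b l s t D : ℝ} (hl : 0 < l) (hs : s ≤ b) (ht : b + 3 * l ≤ t) {E : Set ℝ}
    (hE : MeasurableSet E) (hD : 2 * volume.real (E ∩ Ioc s t) ≤ D)
    (hfE : ∀ r ∈ Ioc s t, r ∉ E → f r = Complex.I ^ turns ⌊(r - b) / l⌋)
    (hsmall : D * (2 * l + D) * (t - s) + l ^ 2 * D < l ^ 3) :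
    ∫ r in s..t, 1 / 2 * (∫ z in s..r, (f z).im) ^ 2 * (f r).re < 0 := by
  have hst : s ≤ t := by linarith
  have hre : ∀ r, |(f r).re| ≤ 1 := fun r => by simpa [h1] using Complex.abs_re_le_norm (f r)
  have him : ∀ r, |(f r).im| ≤ 1 := fun r => by simpa [h1] using Complex.abs_im_le_norm (f r)
  have hfim : ∀ a b, IntervalIntegrable (fun r => (f r).im) volume a b :=
    intervalIntegrable_of_locallyIntegrable
      (locallyIntegrable_of_abs_le_one (Complex.measurable_im.comp hf) him)
  have hfre : ∀ a b, IntervalIntegrable (fun r => (f r).re) volume a b :=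
    intervalIntegrable_of_locallyIntegrable
      (locallyIntegrable_of_abs_le_one (Complex.measurable_re.comp hf) hre)
  have hind : ∀ (S : Set ℝ), MeasurableSet S → ∀ a b,
      IntervalIntegrable (S.indicator fun _ => (1 : ℝ)) volume a b := fun S hS =>
    intervalIntegrable_of_locallyIntegrable
      (locallyIntegrable_of_abs_le_one (measurable_const.indicator hS) fun r => by
        by_cases h : r ∈ S <;> simp [h])
  have hEint : ∀ r ∈ Icc s t, ∫ z in s..r, E.indicator (fun _ => (1 : ℝ)) z ≤ D / 2 := by
    intro r hr
    rw [intervalIntegral.integral_of_le hr.1, integral_indicator hE,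
      Measure.restrict_restrict hE]
    simp only [MeasureTheory.integral_const, smul_eq_mul, mul_one, measureReal_restrict_apply_univ]
    have : volume.real (E ∩ Ioc s r) ≤ volume.real (E ∩ Ioc s t) :=
      measureReal_mono (inter_subset_inter_right _ (Ioc_subset_Ioc_right hr.2))
        (measure_inter_lt_top_of_right_ne_top (by simp)).ne
    linarith
  have hD0 : 0 ≤ D := le_trans (by positivity) hD
  have hfloor : ∀ (r : ℝ) (m : ℤ), ⌊(r - b) / l⌋ = m ↔ b + m * l ≤ r ∧ r < b + (m + 1) * l := by
    intro r m
    rw [Int.floor_eq_iff, le_div_iff₀ hl, div_lt_iff₀ hl]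
    constructor <;> rintro ⟨h, h'⟩ <;> constructor <;> linarith
  -- the transverse displacement of the unperturbed detour
  let Y : ℝ → ℝ := fun r => max 0 (min (r - b) l) - max 0 (min (r - (b + 2 * l)) l)
  have hY0 : ∀ r, 0 ≤ Y r := fun r => by simp only [Y]; grind
  have hYl : ∀ r, Y r ≤ l := fun r => by simp only [Y]; grind
  have hYint : ∀ r ∈ Icc s t, ∫ z in s..r, ((Ico b (b + l)).indicator (fun _ => (1 : ℝ)) z -
      (Ico (b + 2 * l) (b + 2 * l + l)).indicator (fun _ => (1 : ℝ)) z) = Y r := by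
    intro r hr
    rw [intervalIntegral.integral_sub (hind _ measurableSet_Ico _ _)
      (hind _ measurableSet_Ico _ _), integral_indicator_Ico_one hs hr.1,
      integral_indicator_Ico_one (by linarith) hr.1]
  have hyY : ∀ r ∈ Icc s t, |(∫ z in s..r, (f z).im) - Y r| ≤ D := by
    intro r hr
    rw [← hYint r hr, ← intervalIntegral.integral_sub (hfim _ _)
      ((hind _ measurableSet_Ico _ _).sub (hind _ measurableSet_Ico _ _))]
    have hle : ∀ z ∈ Ioc s r, ‖(f z).im - ((Ico b (b + l)).indicator (fun _ => (1 : ℝ)) z -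
        (Ico (b + 2 * l) (b + 2 * l + l)).indicator (fun _ => (1 : ℝ)) z)‖ ≤
        2 * E.indicator (fun _ => (1 : ℝ)) z := by
      intro z hz
      rw [Real.norm_eq_abs]
      have hz1 := abs_le.1 (him z)
      by_cases hzE : z ∈ E
      · simp only [indicator, hzE, if_true, mem_Ico]
        rw [abs_le]
        split_ifs <;> constructor <;> linarith
      · rw [hfE z ⟨hz.1, hz.2.trans hr.2⟩ hzE]
        have f0 := hfloor z 0
        have f1 := hfloor z 1
        have f2 := hfloor z 2
        push_cast at f0 f1 f2
        simp only [indicator, hzE, if_false, mem_Ico, turns]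
        split_ifs <;> first | (simp [pow_succ]; done) | grind
    refine (intervalIntegral.norm_integral_le_of_norm_le hr.1 (ae_of_all _ hle)
      ((hind E hE _ _).const_mul 2)).trans ?_
    rw [intervalIntegral.integral_const_mul]
    linarith [hEint r hr]
  have hpt : ∀ r ∈ Icc s t, r ∈ Ioc s t → (∫ z in s..r, (f z).im) ^ 2 * (f r).re ≤
      -l ^ 2 * (Ico (b + l) (b + l + l)).indicator (fun _ => (1 : ℝ)) r + D * (2 * l + D) +
        2 * l ^ 2 * E.indicator (fun _ => (1 : ℝ)) r := by
    intro r hr hr'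
    have hy := abs_le.1 (hyY r hr)
    set y := ∫ z in s..r, (f z).im
    have hsq : |y ^ 2 - Y r ^ 2| ≤ D * (2 * l + D) := by
      rw [show y ^ 2 - Y r ^ 2 = (y - Y r) * (y + Y r) by ring, abs_mul]
      refine mul_le_mul (hyY r hr) ?_ (abs_nonneg _) hD0
      rw [abs_le]
      constructor <;> linarith [hY0 r, hYl r, hy.1, hy.2]
    have h2 : (y ^ 2 - Y r ^ 2) * (f r).re ≤ D * (2 * l + D) :=
      (le_abs_self _).trans (by
        rw [abs_mul]
        exact (mul_le_of_le_one_right (abs_nonneg _) (hre r)).trans hsq)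
    suffices h3 : Y r ^ 2 * (f r).re ≤
        -l ^ 2 * (Ico (b + l) (b + l + l)).indicator (fun _ => (1 : ℝ)) r +
          2 * l ^ 2 * E.indicator (fun _ => (1 : ℝ)) r by linarith
    -- off `E`, the product `Y² · Re f` vanishes except on the backward piece, where `Y = l`
    by_cases hrE : r ∈ E
    · have h4 : Y r ^ 2 * (f r).re ≤ l ^ 2 :=
        (mul_le_of_le_one_right (sq_nonneg _) (abs_le.1 (hre r)).2).trans
          (pow_le_pow_left₀ (hY0 r) (hYl r) 2)
      simp only [indicator, hrE, if_true]
      split_ifs <;> nlinarith [sq_nonneg l]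
    · rw [hfE r hr' hrE]
      have f0 := hfloor r 0
      have f1 := hfloor r 1
      have f2 := hfloor r 2
      push_cast at f0 f1 f2
      simp only [indicator, hrE, if_false, mem_Ico, turns]
      split_ifs with g0 g1 g2 g3 g4 g5 g6 <;> first
        | (simp [pow_succ]; done)
        | (have : Y r = l := by
            simp only [Y]; grind
           simp [this]; done)
        | (have : Y r = 0 := by
            simp only [Y]; grind
           simp [this]; done)
        | (exfalso; grind)
  have hyc : Continuous fun r => ∫ z in s..r, (f z).im :=
    intervalIntegral.continuous_primitive hfim s
  have hint : IntervalIntegrable (fun r => (∫ z in s..r, (f z).im) ^ 2 * (f r).re) volume s t :=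
    (hfre s t).continuousOn_mul (hyc.pow 2).continuousOn
  have hI := intervalIntegral.integral_mono_on_of_le_Ioo hst hint
    ((((hind (Ico (b + l) (b + l + l)) measurableSet_Ico s t).const_mul (-l ^ 2)).add
      (intervalIntegrable_const (c := D * (2 * l + D)))).add
        ((hind E hE s t).const_mul (2 * l ^ 2)))
    fun r hr => hpt r (Ioo_subset_Icc_self hr) (Ioo_subset_Ioc_self hr)
  rw [intervalIntegral.integral_add (((hind _ measurableSet_Ico s t).const_mul (-l ^ 2)).add
      intervalIntegrable_const) ((hind E hE s t).const_mul (2 * l ^ 2)),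
    intervalIntegral.integral_add ((hind _ measurableSet_Ico s t).const_mul (-l ^ 2))
      intervalIntegrable_const, intervalIntegral.integral_const_mul,
    intervalIntegral.integral_const_mul, intervalIntegral.integral_const,
    integral_indicator_Ico_one (by linarith) hst, smul_eq_mul,
    min_eq_right (by linarith), max_eq_right hl.le] at hI
  have hEt := mul_le_mul_of_nonneg_left (hEint t ⟨hst, le_rfl⟩) (by positivity : 0 ≤ 2 * l ^ 2)
  simp only [mul_assoc, intervalIntegral.integral_const_mul] at hI hEt hsmall ⊢
  nlinarith

/-! ### The control built from nested detours -/

/-- The number of cells of generation `n + 1` in a cell of generation `n`. The cubic growth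
`branching (n + 1) = branching n ^ 3` makes the total relative length of all later detours
comparable to the cube of that of generation `n`, which is the order of its drift. -/
def branching (n : ℕ) : ℕ := 100 ^ 3 ^ n

/-- The number of cells of generation `n` per unit length: the cells are `[p / cells n, (p + 1) / cells n)`
for integers `p`. -/
def cells (n : ℕ) : ℕ := ∏ k ∈ Finset.range n, branching k

/-- The number of quarter turns at time `t` caused by the detours of generation `n`, which occupy the
three cells of generation `n + 1` following the midpoint of each cell of generation `n`. -/
noncomputable def turnAt (n : ℕ) (t : ℝ) : ℕ :=
  turns (⌊cells (n + 1) * t⌋ % branching n - branching n / 2)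

/-- The control after inserting the detours of the first `n` generations. -/
noncomputable def stage (n : ℕ) (t : ℝ) : ℂ := Complex.I ^ ∑ k ∈ Finset.range n, turnAt k t

/-- The control after inserting all detours. The sum has finitely many nonzero terms at almost every `t`;
where it diverges, `tsum` is `0` and the value is `1`. -/
noncomputable def control (t : ℝ) : ℂ := Complex.I ^ ∑' k, turnAt k t

theorem branching_pos (n : ℕ) : 0 < branching n := by unfold branching; positivity

theorem branching_succ (n : ℕ) : branching (n + 1) = branching n ^ 3 := by
  rw [branching, branching, ← pow_mul, pow_succ]

theorem le_branching (n : ℕ) : 100 ≤ branching n :=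
  le_self_pow₀ (by norm_num) (by positivity)

theorem two_mul_branching_div_two (n : ℕ) : 2 * (branching n / 2) = branching n :=
  Nat.mul_div_cancel' (dvd_pow (by norm_num) (by positivity))

theorem branching_mul_two_pow_le (n k : ℕ) : branching n * 2 ^ k ≤ branching (n + k) := by
  induction k with
  | zero => simp
  | succ k ih =>
    rw [← add_assoc, branching_succ, pow_succ]
    have h := le_branching (n + k)
    nlinarith [Nat.mul_le_mul h h]

theorem cells_succ (n : ℕ) : cells (n + 1) = cells n * branching n := Finset.prod_range_succ _ _

theorem cells_pos (n : ℕ) : 0 < cells n := Finset.prod_pos fun k _ => branching_pos k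

theorem cells_dvd {m n : ℕ} (h : m ≤ n) : cells m ∣ cells n :=
  Finset.prod_dvd_prod_of_subset _ _ _ (Finset.range_subset_range.2 h)

theorem le_cells (n : ℕ) : n ≤ cells n := by
  induction n with
  | zero => simp
  | succ n ih =>
    rw [cells_succ]
    nlinarith [le_branching n, cells_pos n]

theorem measurable_turnAt (n : ℕ) : Measurable (turnAt n) :=
  (measurable_of_countable fun m : ℤ => turns (m % branching n - branching n / 2)).comp
    (Int.measurable_floor.comp (measurable_const_mul _))

theorem measurable_stage (n : ℕ) : Measurable (stage n) :=
  (measurable_of_countable fun m : ℕ => Complex.I ^ m).comp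
    (Finset.measurable_fun_sum _ fun k _ => measurable_turnAt k)

theorem measurable_control : Measurable control :=
  (measurable_of_countable fun m : ℕ => Complex.I ^ m).comp
    (Measurable.tsum measurable_turnAt)

theorem control_eq_stage {n : ℕ} {t : ℝ} (h : ∀ m, n ≤ m → turnAt m t = 0) :
    control t = stage n t := by
  rw [control, stage, tsum_eq_sum (s := Finset.range n) fun m hm => h m (by simpa using hm)]

theorem floor_cells_div (n : ℕ) (t : ℝ) :
    ⌊cells (n + 1) * t⌋ / (branching n : ℤ) = ⌊cells n * t⌋ := by
  rw [← Int.floor_div_natCast, cells_succ]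
  have := branching_pos n
  congr 1
  push_cast
  field_simp

theorem floor_cells_eq {m n : ℕ} (hmn : m ≤ n) {s t : ℝ} (h : ⌊cells n * s⌋ = ⌊cells n * t⌋) :
    ⌊cells m * s⌋ = ⌊cells m * t⌋ := by
  induction n, hmn using Nat.le_induction with
  | base => exact h
  | succ n _ ih => exact ih (by rw [← floor_cells_div, h, floor_cells_div])

/-- `stage n` is constant on the cells of generation `n`. -/
theorem stage_congr {n : ℕ} {s t : ℝ} (h : ⌊cells n * s⌋ = ⌊cells n * t⌋) :
    stage n s = stage n t := by
  unfold stage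
  congr 1
  refine Finset.sum_congr rfl fun k hk => ?_
  unfold turnAt
  rw [floor_cells_eq (Finset.mem_range.1 hk) h]

/-- Within its cell of generation `n`, the point `t` sees a detour that starts at the midpoint and has
pieces of length `1 / cells (n + 1)`. -/
theorem turnAt_eq (n : ℕ) (t : ℝ) : turnAt n t =
    turns ⌊(t - (⌊cells n * t⌋ + 1 / 2) / cells n) / (1 / cells (n + 1))⌋ := by
  unfold turnAt
  congr 1
  have h1 := Int.emod_add_mul_ediv ⌊cells (n + 1) * t⌋ (branching n)
  rw [floor_cells_div] at h1
  have hN : (cells n : ℝ) ≠ 0 := by exact_mod_cast (cells_pos n).ne'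
  obtain ⟨K, hK⟩ : ∃ K, branching n = 2 * K := ⟨_, (two_mul_branching_div_two n).symm⟩
  have hK' : (branching n : ℤ) / 2 = K := by omega
  have hK0 : (K : ℝ) ≠ 0 := by
    have := branching_pos n
    exact_mod_cast (by omega : K ≠ 0)
  have h2 : (t - (⌊cells n * t⌋ + 1 / 2) / cells n) / (1 / cells (n + 1)) =
      cells (n + 1) * t - ((branching n * ⌊cells n * t⌋ + K : ℤ) : ℝ) := by
    rw [cells_succ, hK]
    push_cast
    field_simp
  rw [h2, Int.floor_sub_intCast, hK']
  linarith

theorem volume_turnAt_ne_zero_le {n m : ℕ} (hnm : n ≤ m) (p : ℤ) :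
    volume ({t | turnAt m t ≠ 0} ∩ Ico (p / cells n : ℝ) ((p + 1) / cells n)) ≤
      ENNReal.ofReal (3 / (cells n * branching m)) := by
  obtain ⟨R, hR⟩ := cells_dvd hnm
  have hn : (0 : ℝ) < cells n := by exact_mod_cast cells_pos n
  have hm : (0 : ℝ) < cells m := by exact_mod_cast cells_pos m
  have hm' : (0 : ℝ) < cells (m + 1) := by exact_mod_cast cells_pos (m + 1)
  have hMm : (0 : ℝ) < branching m := by exact_mod_cast branching_pos m
  have hR' : (cells m : ℝ) = cells n * R := by exact_mod_cast hR
  have hR0 : (0 : ℝ) < R := by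
    by_contra h
    nlinarith
  let b : ℤ → ℝ := fun q => (q + 1 / 2) / cells m
  have hsub : {t | turnAt m t ≠ 0} ∩ Ico (p / cells n : ℝ) ((p + 1) / cells n) ⊆
      ⋃ q ∈ Finset.Ico (p * R) ((p + 1) * R), Ico (b q) (b q + 3 / cells (m + 1)) := by
    rintro t ⟨ht, ht1, ht2⟩
    rw [div_le_iff₀ hn] at ht1
    rw [lt_div_iff₀ hn] at ht2
    simp only [mem_iUnion, Finset.mem_Ico, exists_prop]
    refine ⟨⌊cells m * t⌋, ⟨Int.le_floor.2 ?_, Int.floor_lt.2 ?_⟩, ?_⟩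
    · push_cast
      rw [hR']
      nlinarith
    · push_cast
      rw [hR']
      nlinarith
    · rw [mem_ofPred_eq, turnAt_eq, Ne, turns_eq_zero_iff, not_or, not_lt, not_le,
        Int.floor_nonneg, Int.floor_lt] at ht
      obtain ⟨h1, h2⟩ := ht
      rw [le_div_iff₀ (by positivity), zero_mul, sub_nonneg] at h1
      rw [div_lt_iff₀ (by positivity)] at h2
      refine ⟨h1, ?_⟩
      push_cast at h2
      rw [mul_one_div] at h2
      simp only [b]
      linarith
  refine (measure_mono hsub).trans ((measure_biUnion_finset_le _ _).trans (le_of_eq ?_))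
  simp only [Real.volume_Ico, add_sub_cancel_left, Finset.sum_const, Int.card_Ico]
  rw [show ((p + 1) * R - p * R : ℤ).toNat = R by
      rw [add_mul, one_mul, add_sub_cancel_left]; simp, nsmul_eq_mul,
    ← ENNReal.ofReal_natCast, ← ENNReal.ofReal_mul hR0.le, cells_succ]
  congr 1
  push_cast
  rw [hR']
  field_simp

theorem tsum_ofReal_div_branching_le {a A : ℝ} (ha : 0 ≤ a) (hA : 0 < A) {m : ℕ}
    (h : A ≤ branching m) :
    ∑' k, ENNReal.ofReal (a / branching (m + k)) ≤ ENNReal.ofReal (2 * a / A) := by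
  have hle : ∀ k, a / branching (m + k) ≤ a / A * (1 / 2) ^ k := fun k => by
    have h1 : (branching m : ℝ) * 2 ^ k ≤ branching (m + k) := by
      exact_mod_cast branching_mul_two_pow_le m k
    rw [one_div, inv_pow, ← div_eq_mul_inv, div_div]
    refine div_le_div_of_nonneg_left ha (by positivity) (le_trans ?_ h1)
    gcongr
  refine (ENNReal.tsum_le_tsum fun k => ENNReal.ofReal_le_ofReal (hle k)).trans ?_
  rw [← ENNReal.ofReal_tsum_of_nonneg (fun k => by positivity)
    (summable_geometric_two.mul_left _), tsum_mul_left, tsum_geometric_two]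
  exact ENNReal.ofReal_le_ofReal (by ring_nf; rfl)

theorem volume_control_ne_stage_le (n : ℕ) (p : ℤ) :
    volume ({t | control t ≠ stage (n + 1) t} ∩ Ico (p / cells n : ℝ) ((p + 1) / cells n)) ≤
      ENNReal.ofReal (6 / (cells n * branching n ^ 3)) := by
  have hn : (0 : ℝ) < cells n := by exact_mod_cast cells_pos n
  have hM : (0 : ℝ) < branching n := by exact_mod_cast branching_pos n
  have hsub : {t | control t ≠ stage (n + 1) t} ∩ Ico (p / cells n : ℝ) ((p + 1) / cells n) ⊆
      ⋃ k, {t | turnAt (n + 1 + k) t ≠ 0} ∩ Ico (p / cells n : ℝ) ((p + 1) / cells n) := by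
    rintro t ⟨ht, htI⟩
    rw [← iUnion_inter]
    refine ⟨?_, htI⟩
    by_contra hcon
    refine ht (control_eq_stage fun m hm => ?_)
    obtain ⟨k, rfl⟩ := Nat.exists_eq_add_of_le hm
    by_contra hk
    exact hcon (mem_iUnion.2 ⟨k, hk⟩)
  refine (measure_mono hsub).trans ((measure_iUnion_le _).trans
    ((ENNReal.tsum_le_tsum fun k => volume_turnAt_ne_zero_le (by omega) p).trans ?_))
  have := tsum_ofReal_div_branching_le (m := n + 1) (a := 3 / cells n) (A := branching n ^ 3) (by positivity)
    (by positivity) (by rw [branching_succ]; push_cast; rfl)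
  simp only [div_div] at this
  refine this.trans (ENNReal.ofReal_le_ofReal (le_of_eq ?_))
  field_simp
  norm_num

/-- By the Borel-Cantelli lemma, almost every point lies in finitely many detours. -/
theorem ae_eventually_turnAt_eq_zero :
    ∀ᵐ t ∂volume.restrict (Ico (0 : ℝ) 1), ∀ᶠ m in atTop, turnAt m t = 0 := by
  have h : ∑' m, volume.restrict (Ico (0 : ℝ) 1) {t | turnAt m t ≠ 0} ≠ ⊤ := by
    refine ne_top_of_le_ne_top ?_ (ENNReal.tsum_le_tsum
      (g := fun m => ENNReal.ofReal (3 / branching m)) fun m =>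
      (Measure.restrict_apply' measurableSet_Ico).trans_le ?_)
    · have := tsum_ofReal_div_branching_le (a := 3) (A := branching 0) (by norm_num)
        (by exact_mod_cast branching_pos 0) le_rfl
      simp only [zero_add] at this
      exact ne_top_of_le_ne_top ENNReal.ofReal_ne_top this
    · simpa [cells] using volume_turnAt_ne_zero_le (Nat.zero_le m) 0
  filter_upwards [ae_eventually_notMem h] with t ht
  filter_upwards [ht] with m hm
  simpa using hm

theorem norm_control (t : ℝ) : ‖control t‖ = 1 := by simp [control]

theorem norm_stage (n : ℕ) (t : ℝ) : ‖stage n t‖ = 1 := by simp [stage]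

/-- In the cell of generation `n` that contains `x`, the drift in the direction of `stage n` from a point
of the first half to a point of the last quarter is negative. -/
theorem drift_lift_control_neg (n : ℕ) (x : ℝ) {s t : ℝ}
    (hs1 : ⌊cells n * x⌋ / cells n ≤ s) (hs2 : s ≤ (⌊cells n * x⌋ + 1 / 2) / cells n)
    (ht1 : (⌊cells n * x⌋ + 3 / 4) / cells n ≤ t) (ht2 : t < (⌊cells n * x⌋ + 1) / cells n) :
    drift (stage n x).re (stage n x).im (lift control s) (lift control t) < 0 := by
  set p : ℤ := ⌊cells n * x⌋ with hp
  -- rotate so that the direction `θ` becomes `1`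
  set θ : ℂ := stage n x with hθ
  have hn : (0 : ℝ) < cells n := by exact_mod_cast cells_pos n
  have hM : (100 : ℝ) ≤ branching n := by exact_mod_cast le_branching n
  have hM0 : (0 : ℝ) < branching n := by linarith
  rw [drift_lift measurable_control norm_control]
  have e1 : ∀ z, θ.re * (control z).im - θ.im * (control z).re =
      (control z * (starRingEnd ℂ) θ).im := fun z => by
    simp; ring
  have e2 : ∀ z, θ.re * (control z).re + θ.im * (control z).im =
      (control z * (starRingEnd ℂ) θ).re := fun z => by
    simp; ring
  simp only [e1, e2]
  have hl : (1 : ℝ) / cells (n + 1) = 1 / (cells n * branching n) := by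
    rw [cells_succ]; push_cast; rfl
  have hvol := volume_control_ne_stage_le n p
  have hmE : MeasurableSet {t | control t ≠ stage (n + 1) t} :=
    (measurableSet_eq_fun measurable_control (measurable_stage (n + 1))).compl
  have hIoc : Ioc s t ⊆ Ico (p / cells n : ℝ) ((p + 1) / cells n) := fun r hr =>
    ⟨hs1.trans hr.1.le, hr.2.trans_lt ht2⟩
  -- `D` is twice the bound on the measure of the later detours in the cell
  refine integral_detour_neg (b := (p + 1 / 2) / cells n) (l := 1 / cells (n + 1))
    (D := 12 / (cells n * branching n ^ 3)) (E := {t | control t ≠ stage (n + 1) t})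
    (measurable_control.mul_const _) (fun r => ?_) ?_ hs2 ?_ hmE ?_ (fun r hr hrE => ?_) ?_
  · rw [norm_mul, RCLike.norm_conj, norm_control, norm_stage, one_mul]
  · rw [hl]; positivity
  · refine le_trans ?_ ht1
    rw [hl, add_div, add_div, add_assoc]
    gcongr
    rw [← mul_div_assoc, mul_one, div_add_div _ _ hn.ne' (by positivity),
      div_le_div_iff₀ (by positivity) hn]
    nlinarith [mul_nonneg (mul_pos hn hn).le (sub_nonneg.2 hM)]
  · have h1 : volume.real ({t | control t ≠ stage (n + 1) t} ∩ Ioc s t) ≤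
        6 / (cells n * branching n ^ 3) :=
      ENNReal.toReal_le_of_le_ofReal (by positivity)
        ((measure_mono (inter_subset_inter_right _ hIoc)).trans hvol)
    refine (mul_le_mul_of_nonneg_left h1 (by norm_num)).trans (le_of_eq ?_)
    ring
  · have hr' := hIoc hr
    have hfl : ⌊cells n * r⌋ = ⌊cells n * x⌋ := by
      rw [← hp, Int.floor_eq_iff]
      have h1 := (div_le_iff₀ hn).1 hr'.1
      have h2 := (lt_div_iff₀ hn).1 hr'.2
      constructor <;> linarith
    have hc : control r = θ * Complex.I ^ turnAt n r := by
      rw [not_not.1 hrE, hθ, ← stage_congr hfl, stage, stage, Finset.sum_range_succ, pow_add]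
    rw [hc, mul_right_comm, Complex.mul_conj', norm_stage, turnAt_eq, hfl]
    simp [hp]
  · have hts : t - s ≤ 1 / cells n := by
      have : (1 : ℝ) / cells n = (p + 1) / cells n - p / cells n := by ring
      linarith
    rw [hl]
    set ρ : ℝ := 1 / branching n with hρ
    set h : ℝ := 1 / cells n with hh
    have hρ0 : 0 < ρ := by positivity
    have hh0 : 0 < h := by positivity
    have hρ1 : ρ ≤ 1 / 100 := one_div_le_one_div_of_le (by norm_num) hM
    have a1 : 12 / ((cells n : ℝ) * branching n ^ 3) = 12 * h * ρ ^ 3 := by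
      rw [hρ, hh]; field_simp
    have a2 : 1 / ((cells n : ℝ) * branching n) = h * ρ := by
      rw [hρ, hh]; field_simp
    rw [a1, a2]
    calc 12 * h * ρ ^ 3 * (2 * (h * ρ) + 12 * h * ρ ^ 3) * (t - s) + (h * ρ) ^ 2 * (12 * h * ρ ^ 3)
        ≤ 12 * h * ρ ^ 3 * (2 * (h * ρ) + 12 * h * ρ ^ 3) * h +
          (h * ρ) ^ 2 * (12 * h * ρ ^ 3) := by gcongr
      _ = (h * ρ) ^ 3 * (24 * ρ + 144 * ρ ^ 3 + 12 * ρ ^ 2) := by ring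
      _ < (h * ρ) ^ 3 * 1 := by
          refine mul_lt_mul_of_pos_left ?_ (by positivity)
          nlinarith [mul_nonneg hρ0.le (sub_nonneg.2 hρ1),
            mul_nonneg (sq_nonneg ρ) (sub_nonneg.2 hρ1)]
      _ = (h * ρ) ^ 3 := mul_one _

/-! ### Density points and the coincidence set -/

/-- Around almost every point of `K`, all small cells meet `K` in their first half and in their last
quarter: the density of `K` in these cells tends to `1`. -/
theorem eventually_exists_mem_cell (K : Set ℝ) :
    ∀ᵐ x : ℝ ∂volume.restrict K, ∀ᶠ n in atTop,
      (∃ s ∈ K, (⌊cells n * x⌋ : ℝ) / cells n ≤ s ∧ s ≤ ((⌊cells n * x⌋ : ℝ) + 1 / 2) / cells n) ∧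
      ∃ t ∈ K, ((⌊cells n * x⌋ : ℝ) + 3 / 4) / cells n ≤ t ∧ t < ((⌊cells n * x⌋ : ℝ) + 1) / cells n := by
  have hc : ∀ n, (0 : ℝ) < cells n := fun n => by exact_mod_cast cells_pos n
  filter_upwards [IsUnifLocDoublingMeasure.ae_tendsto_measure_inter_div (volume : Measure ℝ) K 1]
    with x hx
  have hlim : Tendsto (fun n => 1 / 2 / (cells n : ℝ)) atTop (𝓝[>] 0) := by
    refine tendsto_nhdsWithin_iff.2 ⟨?_, Eventually.of_forall fun n => by
      have := hc n
      simp only [mem_Ioi]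
      positivity⟩
    exact tendsto_const_nhds.div_atTop (tendsto_natCast_atTop_atTop.comp
      (tendsto_atTop_mono le_cells tendsto_id))
  have hd := hx (fun n => (⌊cells n * x⌋ + 1 / 2) / cells n) (fun n => 1 / 2 / (cells n : ℝ)) hlim
    (Eventually.of_forall fun n => by
      have h1 := Int.floor_le (cells n * x)
      have h2 := (Int.lt_floor_add_one (cells n * x)).le
      rw [one_mul, Real.closedBall_eq_Icc, ← sub_div, ← add_div]
      constructor
      · rw [div_le_iff₀ (hc n)]; linarith
      · rw [le_div_iff₀ (hc n)]; linarith)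
  have h45 : ENNReal.ofReal (4 / 5) < 1 := by
    rw [ENNReal.ofReal_lt_one]; norm_num
  -- a set of density `4/5` in a cell cannot miss its first half or its last quarter
  filter_upwards [hd.eventually (lt_mem_nhds h45)] with n hn
  have hN := hc n
  set N : ℝ := ((cells n : ℕ) : ℝ)
  set p : ℝ := (⌊N * x⌋ : ℝ)
  rw [Real.closedBall_eq_Icc, ← sub_div, ← add_div, show p + 1 / 2 - 1 / 2 = p by ring,
    show p + 1 / 2 + 1 / 2 = p + 1 by ring, Real.volume_Icc,
    show (p + 1) / N - p / N = 1 / N by ring,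
    ENNReal.lt_div_iff_mul_lt (Or.inl (by simpa using hN)) (Or.inl (by simp)),
    ← ENNReal.ofReal_mul (by norm_num)] at hn
  constructor
  · by_contra! hcon
    refine (hn.trans_le ((measure_mono (t := Icc ((p + 1 / 2) / N) ((p + 1) / N))
      fun z hz => ⟨(hcon z hz.1 hz.2.1).le, hz.2.2⟩).trans_eq Real.volume_Icc)).not_ge
      (ENNReal.ofReal_le_ofReal ?_)
    rw [← sub_div, ← mul_div_assoc]
    gcongr
    linarith
  · by_contra! hcon
    refine (hn.trans_le ((measure_mono (t := Icc (p / N) ((p + 3 / 4) / N) ∪ {(p + 1) / N})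
      fun z hz => ?_).trans (measure_union_le _ _))).not_ge ?_
    · by_cases h : (p + 3 / 4) / N ≤ z
      · exact Or.inr (le_antisymm hz.2.2 (hcon z hz.1 h))
      · exact Or.inl ⟨hz.2.1, (not_le.1 h).le⟩
    · rw [Real.volume_singleton, add_zero, Real.volume_Icc]
      refine ENNReal.ofReal_le_ofReal ?_
      rw [← sub_div, ← mul_div_assoc]
      gcongr
      linarith

/-- A `C¹_H` curve meets the lift of `control` in a null set of parameters. -/
theorem volume_eq_lift_control {Γ : ℝ → Cartan} (hΓ : IsC1H Γ 0 1) :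
    volume {t : ℝ | t ∈ Icc (0 : ℝ) 1 ∧ Γ t = lift control t} = 0 := by
  obtain ⟨v₁, v₂, hv₁, hv₂, hdΓ⟩ := hΓ.exists_continuousOn_controls one_pos
  set K : Set ℝ := {t | t ∈ Icc (0 : ℝ) 1 ∧ Γ t = lift control t} with hK
  have hKI : K ⊆ Icc 0 1 := fun t ht => ht.1
  have hKm : MeasurableSet K := by
    obtain ⟨C, hC⟩ := exists_lipschitzOnWith_lift measurable_control norm_control 0 1
    rw [uIcc_of_le zero_le_one] at hC
    exact ((hΓ.2.continuousOn.prodMk hC.continuousOn).preimage_isClosed_of_isClosed isClosed_Icc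
      isClosed_diagonal).measurableSet
  rw [← Measure.restrict_eq_zero, ← ae_eq_bot, ← not_neBot]
  intro hne
  have h01 : ∀ᵐ t ∂volume.restrict K, ∀ᶠ m in atTop, turnAt m t = 0 :=
    ae_mono ((Measure.restrict_mono hKI le_rfl).trans_eq
      (Measure.restrict_congr_set Ico_ae_eq_Icc).symm) ae_eventually_turnAt_eq_zero
  obtain ⟨x, hxK, hx, hcell, hγ⟩ := ((ae_restrict_mem hKm).and (h01.and
    ((eventually_exists_mem_cell K).and
      (ae_restrict_of_ae (ae_hasDerivAt_lift measurable_control norm_control))))).exists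
  have key : ∀ ε > 0, ∃ s ∈ K, ∃ t ∈ K, s < t ∧ |s - x| < ε ∧ |t - x| < ε ∧
      drift (control x).re (control x).im (lift control s) (lift control t) < 0 := by
    intro ε hε
    obtain ⟨n₀, hn₀⟩ := eventually_atTop.1 hx
    obtain ⟨n₁, hn₁⟩ := exists_nat_one_div_lt hε
    obtain ⟨n, ⟨⟨s, hs, hs1, hs2⟩, t, ht, ht1, ht2⟩, hn⟩ :=
      (hcell.and (eventually_ge_atTop (max n₀ (n₁ + 1)))).exists
    have hN : (0 : ℝ) < cells n := by exact_mod_cast cells_pos n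
    have hNε : 1 / (cells n : ℝ) < ε := by
      refine lt_of_le_of_lt (one_div_le_one_div_of_le (by positivity) ?_) hn₁
      exact_mod_cast ((le_max_right _ _).trans hn).trans (le_cells n)
    have hlt : s < t := by
      refine hs2.trans_lt (lt_of_lt_of_le ?_ ht1)
      rw [div_lt_div_iff_of_pos_right hN]
      linarith
    have hx1 : ⌊cells n * x⌋ / cells n ≤ x := by
      rw [div_le_iff₀ hN, mul_comm]
      exact Int.floor_le _
    have hx2 : x < (⌊cells n * x⌋ + 1) / cells n := by
      rw [lt_div_iff₀ hN, mul_comm]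
      exact Int.lt_floor_add_one _
    have hw : ((⌊cells n * x⌋ : ℝ) + 1) / cells n = ⌊cells n * x⌋ / cells n + 1 / cells n :=
      add_div _ _ _
    refine ⟨s, hs, t, ht, hlt, ?_, ?_, ?_⟩
    · rw [abs_lt]; constructor <;> linarith
    · rw [abs_lt]; constructor <;> linarith
    · rw [control_eq_stage fun m hm => hn₀ m (((le_max_left _ _).trans hn).trans hm)]
      exact drift_lift_control_neg n x hs1 hs2 ht1 ht2
  -- `x` is not isolated in `K`, so the two curves have the same velocity at `x`
  have hacc : AccPt x (𝓟 K) := by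
    rw [accPt_iff_nhds]
    intro U hU
    obtain ⟨ε, hε, hεU⟩ := Metric.mem_nhds_iff.1 hU
    obtain ⟨s, hs, t, ht, hst, hsε, htε, -⟩ := key ε hε
    by_cases h : s = x
    · exact ⟨t, ⟨hεU htε, ht⟩, by rw [← h]; exact hst.ne'⟩
    · exact ⟨s, ⟨hεU hsε, hs⟩, h⟩
  have hderiv : v₁ x • X₁ (Γ x) + v₂ x • X₂ (Γ x) =
      (control x).re • X₁ (lift control x) + (control x).im • X₂ (lift control x) :=
    (uniqueDiffWithinAt_iff_accPt.2 hacc).eq_deriv K ((hdΓ x hxK.1).mono hKI)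
      (hγ.hasDerivWithinAt.congr (fun t ht => ht.2) hxK.2)
  have hv₁x : v₁ x = (control x).re := by
    simpa [X₁, X₂] using congrArg (fun z : Cartan => z 0) hderiv
  have hv₂x : v₂ x = (control x).im := by
    simpa [X₁, X₂] using congrArg (fun z : Cartan => z 1) hderiv
  have hpos : 0 < (control x).re * v₁ x + (control x).im * v₂ x := by
    rw [hv₁x, hv₂x, ← Complex.normSq_apply, Complex.normSq_eq_norm_sq, norm_control]
    norm_num
  have hcont : ContinuousWithinAt (fun r => (control x).re * v₁ r + (control x).im * v₂ r)
      (Icc 0 1) x := ((hv₁ x hxK.1).const_mul _).add ((hv₂ x hxK.1).const_mul _)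
  obtain ⟨ε, hε, hεpos⟩ := Metric.mem_nhdsWithin_iff.1 (hcont.eventually (lt_mem_nhds hpos))
  obtain ⟨s, hs, t, ht, hst, hsε, htε, hneg⟩ := key ε hε
  have hsub : Icc s t ⊆ Icc 0 1 := Icc_subset_Icc (hKI hs).1 (hKI ht).2
  have hnonneg := drift_nonneg (p := (control x).re) (q := (control x).im) hst.le
    (fun r hr => (hdΓ r (hsub hr)).mono hsub) fun r hr => by
      refine (hεpos ⟨?_, hsub hr⟩).le
      rw [abs_lt] at hsε htε
      rw [Metric.mem_ball, Real.dist_eq, abs_lt]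
      constructor <;> linarith [hr.1, hr.2]
  rw [hs.2, ht.2] at hnonneg
  exact hnonneg.not_gt hneg

end Cartan

theorem theorem1p2 :
    ∃ γ : ℝ → Cartan, (∃ L : ℝ, 0 < L ∧ Cartan.IsLipschitzCurve L γ (Set.Icc 0 1)) ∧
      ∀ Γ : ℝ → Cartan, Cartan.IsC1H Γ 0 1 →
        MeasureTheory.volume {t : ℝ | t ∈ Set.Icc (0 : ℝ) 1 ∧ Γ t = γ t} = 0 :=
  ⟨Cartan.lift Cartan.control, ⟨1, one_pos, Cartan.isLipschitzCurve_lift Cartan.measurable_control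
    Cartan.norm_control _⟩, fun _ hΓ => Cartan.volume_eq_lift_control hΓ⟩
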